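/- Let $0<\mu_1<\mu_2<\cdots$ be real numbers satisfying (A1) $\mu_n = M n^{\beta}\bigl(1+o(n^{-\sigma})\bigr)$ as $n\to\infty$, for some $M>0$, $\beta>1$, $\sigma\in(0,1]$; (A2) $\mu_{n+1}-\mu_n\ge \theta n^{-s}$ for all $n\ge 1$, for some $\theta>0$, $s\ge 0$. For $T\in(0,\infty]$ let $\mathcal E_T^n$ be the closed linear span in the real space $L^2[0,T]$ ($L^2[0,\infty)$ if $T=\infty$) of the functions $e^{-\mu_k t}$, $k\ne n$. Let $d_n(T)$ be the $L^2[0,T]$-distance from $e^{-\mu_n t}$ to $\mathcal E_T^n$, let $r_n\in\mathcal E_T^n$ be the unique nearest element to $e^{-\mu_n t}$, and put $$\varphi_n=\frac{e^{-\mu_n t}-r_n}{d_n(T)^2}.$$ Then: 1. For every $T\in(0,\infty]$ there is a constant $\kappa(T)>0$ such that $d_n(T)\ge\kappa(T)^{-1}d_n(\infty)$ for all $n\ge1$. 2. There are constants $K_0,K_1>0$, independent of $n$, such that for all $n\ge 1$ $$\Bigl|\prod_{j\ne n}\Bigl(1-\frac{\mu_n}{\mu_j}\Bigr)\Bigr|\ge\exp\bigl(-K_0M^{-1/\beta}\mu_n^{1/\beta}(\log\mu_n+K_1)\bigr).\qquad(*)$$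 3. For any $K_0,K_1>0$ satisfying $(*)$ for all $n\ge 1$ there is a constant $K_2>0$, independent of $n$ and $T$, such that for every $T\in(0,\infty]$ and every $n\ge1$: $d_n(T)>0$; $\varphi_n$ satisfies $\int_0^T e^{-\mu_k t}\varphi_n(t)\,dt=\delta_{kn}$ for all $k\ge 1$ and has the least $L^2[0,T]$ norm among all functions in $L^2[0,T]$ with this property; and, for every $\kappa(T)$ as in 1, $$\|\varphi_n\|_{L^2[0,T]}\le\sqrt{\frac{\mu_n}{2}}\;\kappa(T)\,\exp\bigl(K_0M^{-1/\beta}\mu_n^{1/\beta}(\log\mu_n+K_2)\bigr).$$ -/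

import Mathlib

open MeasureTheory Filter Asymptotics
open scoped Topology

noncomputable section

namespace ExpMoment

/-- The time interval `[0, T]`, where `T = ⊤` gives `[0, ∞)`. -/
def timeInterval (T : EReal) : Set ℝ := {t : ℝ | 0 ≤ t ∧ (t : EReal) ≤ T}

/-- Lebesgue measure on the time interval. -/
def timeMeasure (T : EReal) : Measure ℝ := volume.restrict (timeInterval T)

/-- The real Hilbert space `L²[0, T]`. -/
abbrev L2 (T : EReal) : Type := Lp ℝ 2 (timeMeasure T)

theorem memLp_exp (T : EReal) {a : ℝ} (ha : 0 < a) :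
    MemLp (fun t : ℝ => Real.exp (-a * t)) 2 (timeMeasure T) := by
  have hc : Continuous fun t : ℝ => Real.exp (-a * t) := by fun_prop
  have h0 : MemLp (fun t : ℝ => Real.exp (-a * t)) 2 (volume.restrict (Set.Ici (0 : ℝ))) := by
    rw [memLp_two_iff_integrable_sq hc.aestronglyMeasurable]
    have h1 := integrableOn_exp_mul_Ioi (a := -(2 * a)) (by linarith) 0
    have h2 := (integrableOn_Ici_iff_integrableOn_Ioi).2 h1
    refine Integrable.congr h2 (Eventually.of_forall fun t => ?_)
    simp only [← Real.exp_nat_mul]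
    congr 1
    push_cast
    ring
  exact h0.mono_measure (Measure.restrict_mono (fun t ht => ht.1) le_rfl)

/-- The function `t ↦ exp (-μ_n t)` as an element of `L²[0, T]`. -/
def expL2 (T : EReal) (μ : ℕ → ℝ) (hpos : ∀ n, 0 < μ n) (n : ℕ) : L2 T :=
  (memLp_exp T (hpos n)).toLp _

/-- The smallest closed subspace of `L²[0, T]` containing `exp (-μ_k t)` for all `k ≠ n`. -/
def closedSpanExcept (T : EReal) (μ : ℕ → ℝ) (hpos : ∀ n, 0 < μ n) (n : ℕ) :
    Submodule ℝ (L2 T) :=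
  (Submodule.span ℝ (expL2 T μ hpos '' {k | k ≠ n})).topologicalClosure

instance instCompleteClosedSpanExcept (T : EReal) (μ : ℕ → ℝ) (hpos : ∀ n, 0 < μ n) (n : ℕ) :
    CompleteSpace (closedSpanExcept T μ hpos n) :=
  (Submodule.isClosed_topologicalClosure _).completeSpace_coe

/-- `d_n(T)`, the distance in `L²[0, T]` from `exp (-μ_n t)` to the closed span of the others. -/
def dist (T : EReal) (μ : ℕ → ℝ) (hpos : ∀ n, 0 < μ n) (n : ℕ) : ℝ :=
  Metric.infDist (expL2 T μ hpos n) (closedSpanExcept T μ hpos n : Set (L2 T))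

/-- `r_n`, the element of the closed span of the others that is nearest to `exp (-μ_n t)`. -/
def nearest (T : EReal) (μ : ℕ → ℝ) (hpos : ∀ n, 0 < μ n) (n : ℕ) : L2 T :=
  (closedSpanExcept T μ hpos n).starProjection (expL2 T μ hpos n)

/-- `r_n` lies in the closed span and attains the distance. -/
theorem nearest_spec (T : EReal) (μ : ℕ → ℝ) (hpos : ∀ n, 0 < μ n) (n : ℕ) :
    nearest T μ hpos n ∈ closedSpanExcept T μ hpos n ∧
      ‖expL2 T μ hpos n - nearest T μ hpos n‖ = dist T μ hpos n := by
  refine ⟨Submodule.starProjection_apply_mem _ _, ?_⟩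
  rw [nearest, Submodule.starProjection_minimal, dist, Metric.infDist_eq_iInf]
  simp only [dist_eq_norm]
  rfl

/-- The optimal bi-orthogonal function `φ_n = (exp (-μ_n t) - r_n) / d_n(T)²`. -/
def biorth (T : EReal) (μ : ℕ → ℝ) (hpos : ∀ n, 0 < μ n) (n : ℕ) : L2 T :=
  (dist T μ hpos n ^ 2)⁻¹ • (expL2 T μ hpos n - nearest T μ hpos n)

/-- `ψ` is an `n`-th bi-orthogonal function: `∫₀ᵀ exp (-μ_k t) ψ(t) dt = δ_{kn}` for all `k`. -/
def IsBiorthAt (T : EReal) (μ : ℕ → ℝ) (n : ℕ) (ψ : L2 T) : Prop :=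
  ∀ k : ℕ, ∫ t, Real.exp (-μ k * t) * ψ t ∂(timeMeasure T) = if k = n then 1 else 0

/-- `κ` is an admissible comparison constant: `κ > 0` and `d_n(T) ≥ κ⁻¹ d_n(∞)` for all `n`. -/
def IsComparisonConst (T : EReal) (μ : ℕ → ℝ) (hpos : ∀ n, 0 < μ n) (κ : ℝ) : Prop :=
  0 < κ ∧ ∀ n : ℕ, κ⁻¹ * dist ⊤ μ hpos n ≤ dist T μ hpos n

/-- `μ_n = M n^β (1 + o(n^{-σ}))`; the sequence `μ_1, μ_2, …` is stored as `μ 0, μ 1, …`. -/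
def PowerGrowth (μ : ℕ → ℝ) (M β σ : ℝ) : Prop :=
  ∃ ε : ℕ → ℝ, (ε =o[atTop] fun n : ℕ => ((n : ℝ) + 1) ^ (-σ)) ∧
    ∀ n : ℕ, μ n = M * ((n : ℝ) + 1) ^ β * (1 + ε n)

/-- `μ_{n+1} - μ_n ≥ θ n^{-s}` for all `n ≥ 1`, with the same shift of the index. -/
def GapCondition (μ : ℕ → ℝ) (θ s : ℝ) : Prop :=
  ∀ n : ℕ, θ * ((n : ℝ) + 1) ^ (-s) ≤ μ (n + 1) - μ n

/-- `|∏_{j ≠ n} (1 - μ_n / μ_j)| ≥ exp (-K₀ M^{-1/β} μ_n^{1/β} (log μ_n + K₁))` for all `n`,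
with positive `K₀` and `K₁`. -/
def ProductLowerBound (μ : ℕ → ℝ) (M β K₀ K₁ : ℝ) : Prop :=
  0 < K₀ ∧ 0 < K₁ ∧ ∀ n : ℕ,
    Real.exp (-(K₀ * M ^ (-1 / β) * μ n ^ (1 / β) * (Real.log (μ n) + K₁))) ≤
      |∏' j : {j : ℕ // j ≠ n}, (1 - μ n / μ j)|

end ExpMoment

end

namespace ExpMoment

/-! Everything rests on a coefficient bound `|a n| ≤ R n * ‖∑ a_k exp (-μ_k t)‖` in L²[0,∞). The
Gram matrix there is the Cauchy matrix 1/(μ_k + μ_l). Multiplying every a_k by the Blaschke factor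
(μ_k - μ_m)/(μ_k + μ_m) does not increase its quadratic form (`quadForm_le`). Doing so for all m ≠ n
in the support leaves only the diagonal term at n (`sq_coeff_le_quadForm`). So R n may be any upper
bound for √(2μ_n) divided by these Blaschke products, which are quotients of ∏|1 - μ_n/μ_j| by ∏(1 +
μ_n/μ_j). The denominators are at most exp(B μ_n^{1/β}), with no logarithm, so `ProductLowerBound`
yields R n = `coeffBound` at the sole cost of enlarging K₁ to K₂.

The product lower bound itself splits at j of order n. The far factors lose only exp(-O(n)) because
β > 1, and each of the O(n) near factors is at least a negative power of n by the gap condition.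

The comparison of [0,T] with [0,∞) is a compactness argument (`not_tendsto_zero_of_norm_eq_one`).
Sums of norm 1 on [0,∞) with norms tending to 0 on [0,T] have coefficients bounded by R, so they
subconverge to a Dirichlet series that vanishes on (0,T), hence everywhere by analyticity, and no
mass is left on (T,∞). Finally 1/d_n(∞) ≤ R n and ‖φ_n‖ = 1/d_n(T). -/

theorem PowerGrowth.exists_bounds {μ : ℕ → ℝ} {M β σ : ℝ} (hM : 0 < M) (hσ : 0 < σ)
    (hpos : ∀ n, 0 < μ n) (h : PowerGrowth μ M β σ) :
    ∃ c C : ℝ, 0 < c ∧ 0 < C ∧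
      ∀ n : ℕ, c * ((n : ℝ) + 1) ^ β ≤ μ n ∧ μ n ≤ C * ((n : ℝ) + 1) ^ β := by
  obtain ⟨ε, hε, hμ⟩ := h
  have hp : ∀ n : ℕ, 0 < ((n : ℝ) + 1) ^ β := fun n => by positivity
  have h0 : Tendsto ε atTop (𝓝 0) := by
    refine hε.trans_tendsto ?_
    exact (tendsto_rpow_neg_atTop hσ).comp
      (tendsto_atTop_add_const_right _ _ tendsto_natCast_atTop_atTop)
  have h1 : Tendsto (fun n => μ n / ((n : ℝ) + 1) ^ β) atTop (𝓝 M) := by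
    have : Tendsto (fun n => M * (1 + ε n)) atTop (𝓝 (M * (1 + 0))) :=
      (h0.const_add 1).const_mul M
    rw [add_zero, mul_one] at this
    refine this.congr fun n => ?_
    rw [hμ n, eq_div_iff (hp n).ne']
    ring
  obtain ⟨C, hC⟩ := h1.bddAbove_range
  obtain ⟨D, hD⟩ := (h1.inv₀ hM.ne').bddAbove_range
  have hC' : ∀ n, μ n / ((n : ℝ) + 1) ^ β ≤ C := fun n => hC ⟨n, rfl⟩
  have hD' : ∀ n, (μ n / ((n : ℝ) + 1) ^ β)⁻¹ ≤ D := fun n => hD ⟨n, rfl⟩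
  have hDpos : 0 < D := lt_of_lt_of_le (inv_pos.2 (div_pos (hpos 0) (hp 0))) (hD' 0)
  refine ⟨D⁻¹, C, inv_pos.2 hDpos, (div_pos (hpos 0) (hp 0)).trans_le (hC' 0), fun n => ⟨?_, ?_⟩⟩
  · have := inv_anti₀ (inv_pos.2 (div_pos (hpos n) (hp n))) (hD' n)
    rwa [inv_inv, le_div_iff₀ (hp n)] at this
  · exact (div_le_iff₀ (hp n)).1 (hC' n)

/-! ### Finite products of 1 ± μ_n/μ_j. -/

/-- The value of the series `∑ q^{-β}`. -/
noncomputable def zetaSum (β : ℝ) : ℝ := ∑' q : ℕ, ((q : ℝ) ^ β)⁻¹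

theorem zetaSum_nonneg (β : ℝ) : 0 ≤ zetaSum β := tsum_nonneg fun q => by positivity

/-- Group the indices by q = j / W ≥ 1: a block has at most W members, each contributing at most
q^{-β}. -/
theorem sum_tail_le {β : ℝ} (hβ : 1 < β) {W : ℕ} (hW : 0 < W) (F : Finset ℕ)
    (hF : ∀ j ∈ F, W ≤ j) :
    ∑ j ∈ F, ((W : ℝ) / ((j : ℝ) + 1)) ^ β ≤ W * zetaSum β := by
  have hWr : (0 : ℝ) < W := by exact_mod_cast hW
  have hs : Summable fun q : ℕ => ((q : ℝ) ^ β)⁻¹ := Real.summable_nat_rpow_inv.2 hβ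
  calc ∑ j ∈ F, ((W : ℝ) / ((j : ℝ) + 1)) ^ β
      ≤ ∑ j ∈ F, (((j / W : ℕ) : ℝ) ^ β)⁻¹ := by
        refine Finset.sum_le_sum fun j hj => ?_
        have hq : 0 < j / W := Nat.div_pos (hF j hj) hW
        have hqr : (0 : ℝ) < ((j / W : ℕ) : ℝ) := by exact_mod_cast hq
        rw [← Real.inv_rpow hqr.le]
        refine Real.rpow_le_rpow (by positivity) ?_ (by linarith)
        rw [div_le_iff₀ (by positivity), inv_mul_eq_div, le_div_iff₀ hqr]
        have := Nat.mul_div_le j W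
        have h2 : (W : ℝ) * ((j / W : ℕ) : ℝ) ≤ j := by exact_mod_cast this
        linarith
    _ = ∑ q ∈ F.image (fun j => j / W),
          (F.filter fun j => j / W = q).card • ((q : ℝ) ^ β)⁻¹ :=
        Finset.sum_comp (fun q : ℕ => ((q : ℝ) ^ β)⁻¹) (fun j => j / W)
    _ ≤ ∑ q ∈ F.image (fun j => j / W), (W : ℝ) * ((q : ℝ) ^ β)⁻¹ := by
        refine Finset.sum_le_sum fun q _ => ?_
        rw [nsmul_eq_mul]
        refine mul_le_mul_of_nonneg_right ?_ (by positivity)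
        have hsub : (F.filter fun j => j / W = q) ⊆ Finset.Ico (q * W) (q * W + W) := by
          intro j hj
          have hj' := (Finset.mem_filter.1 hj).2
          have h1 := Nat.div_add_mod j W
          have h2 := Nat.mod_lt j hW
          rw [hj'] at h1
          rw [Finset.mem_Ico, Nat.mul_comm q W]
          omega
        have := Finset.card_le_card hsub
        rw [Nat.card_Ico, Nat.add_sub_cancel_left] at this
        exact_mod_cast this
    _ ≤ W * zetaSum β := by
        rw [← Finset.mul_sum]
        exact mul_le_mul_of_nonneg_left (hs.sum_le_tsum _ fun q _ => by positivity) hWr.le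

theorem sum_inv_sqrt_le (W : ℕ) :
    ∑ j ∈ Finset.range W, (Real.sqrt ((j : ℝ) + 1))⁻¹ ≤ 2 * Real.sqrt W := by
  induction W with
  | zero => simp
  | succ k ih =>
    rw [Finset.sum_range_succ]
    push_cast
    have hp : 0 < Real.sqrt ((k : ℝ) + 1) := Real.sqrt_pos.2 (by positivity)
    have h1 := Real.sq_sqrt (show (0 : ℝ) ≤ (k : ℝ) + 1 by positivity)
    have h2 := Real.sq_sqrt (show (0 : ℝ) ≤ (k : ℝ) by positivity)
    have h3 : (Real.sqrt ((k : ℝ) + 1))⁻¹ ≤ 2 * Real.sqrt ((k : ℝ) + 1) - 2 * Real.sqrt k := by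
      rw [inv_le_iff_one_le_mul₀ hp]
      nlinarith [sq_nonneg (Real.sqrt ((k : ℝ) + 1) - Real.sqrt k)]
    linarith

/-- The square root is chosen because ∑_{j ≤ W} √(W/j) = O(W), so the factors with W/j large cost no
logarithm. -/
theorem one_add_rpow_le_exp {β y : ℝ} (hβ : 1 < β) (hy : 0 ≤ y) :
    1 + y ^ β ≤ Real.exp (2 * β * Real.sqrt y) := by
  have h1 : 1 + y ^ β ≤ (1 + y) ^ β := by
    have := Real.add_rpow_le_rpow_add zero_le_one hy hβ.le
    rwa [Real.one_rpow] at this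
  have h2 : 1 + y ≤ Real.exp (2 * Real.sqrt y) := by
    have h3 := Real.add_one_le_exp (Real.sqrt y)
    have h4 := Real.sq_sqrt hy
    have h5 := Real.sqrt_nonneg y
    rw [two_mul, Real.exp_add]
    nlinarith
  calc 1 + y ^ β ≤ (1 + y) ^ β := h1
    _ ≤ (Real.exp (2 * Real.sqrt y)) ^ β := Real.rpow_le_rpow (by positivity) h2 (by linarith)
    _ = Real.exp (2 * β * Real.sqrt y) := by rw [← Real.exp_mul]; congr 1; ring

theorem prod_one_add_rpow_le {β : ℝ} (hβ : 1 < β) {W : ℕ} (hW : 0 < W) (F : Finset ℕ) :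
    ∏ j ∈ F, (1 + ((W : ℝ) / ((j : ℝ) + 1)) ^ β) ≤ Real.exp ((4 * β + zetaSum β) * W) := by
  rw [← Finset.prod_filter_mul_prod_filter_not F (fun j => W ≤ j), add_mul, add_comm,
    Real.exp_add]
  have hWr : (0 : ℝ) < W := by exact_mod_cast hW
  refine mul_le_mul ?_ ?_ (Finset.prod_nonneg fun j _ => by positivity) (Real.exp_pos _).le
  · calc _ ≤ ∏ j ∈ F.filter (fun j => W ≤ j), Real.exp (((W : ℝ) / ((j : ℝ) + 1)) ^ β) := by
          refine Finset.prod_le_prod (fun j _ => by positivity) fun j _ => ?_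
          rw [add_comm]
          exact Real.add_one_le_exp _
      _ ≤ _ := by
          rw [← Real.exp_sum, Real.exp_le_exp, mul_comm (zetaSum β)]
          exact sum_tail_le hβ hW _ fun j hj => (Finset.mem_filter.1 hj).2
  · calc _ ≤ ∏ j ∈ F.filter (fun j => ¬ W ≤ j),
            Real.exp (2 * β * Real.sqrt ((W : ℝ) / ((j : ℝ) + 1))) :=
          Finset.prod_le_prod (fun j _ => by positivity) fun j _ =>
            one_add_rpow_le_exp hβ (by positivity)
      _ = Real.exp (∑ j ∈ F.filter (fun j => ¬ W ≤ j),
            2 * β * Real.sqrt ((W : ℝ) / ((j : ℝ) + 1))) := (Real.exp_sum _ _).symm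
      _ ≤ _ := by
          rw [Real.exp_le_exp]
          calc _ ≤ ∑ j ∈ Finset.range W, 2 * β * Real.sqrt ((W : ℝ) / ((j : ℝ) + 1)) := by
                refine Finset.sum_le_sum_of_subset_of_nonneg (fun j hj => ?_)
                  fun j _ _ => by positivity
                exact Finset.mem_range.2 (not_le.1 (Finset.mem_filter.1 hj).2)
            _ = 2 * β * Real.sqrt W * ∑ j ∈ Finset.range W, (Real.sqrt ((j : ℝ) + 1))⁻¹ := by
                rw [Finset.mul_sum]
                refine Finset.sum_congr rfl fun j _ => ?_
                rw [Real.sqrt_div hWr.le, div_eq_mul_inv, mul_assoc (2 * β)]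
            _ ≤ 2 * β * Real.sqrt W * (2 * Real.sqrt W) :=
                mul_le_mul_of_nonneg_left (sum_inv_sqrt_le W) (by positivity)
            _ = 4 * β * W := by
                have := Real.sq_sqrt hWr.le
                linear_combination 4 * β * this

/-- By monotonicity only the two neighbours of n matter; the gap below n is the larger of the two
bounds since s ≥ 0. -/
theorem GapCondition.le_abs_sub {μ : ℕ → ℝ} {θ s : ℝ} (hmono : StrictMono μ) (hθ : 0 < θ)
    (hs : 0 ≤ s) (h : GapCondition μ θ s) {j n : ℕ} (hjn : j ≠ n) :
    θ * ((n : ℝ) + 1) ^ (-s) ≤ |μ j - μ n| := by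
  rcases lt_or_gt_of_ne hjn with hlt | hgt
  · obtain ⟨m, rfl⟩ : ∃ m, n = m + 1 := ⟨n - 1, by omega⟩
    have h1 : μ j ≤ μ m := hmono.monotone (by omega)
    have h2 := h m
    have h3 : θ * (((m + 1 : ℕ) : ℝ) + 1) ^ (-s) ≤ θ * ((m : ℝ) + 1) ^ (-s) := by
      refine mul_le_mul_of_nonneg_left ?_ hθ.le
      refine Real.rpow_le_rpow_of_nonpos (by positivity) ?_ (by linarith)
      push_cast; linarith
    rw [abs_sub_comm]
    exact le_trans (by linarith) (le_abs_self _)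
  · have h1 : μ (n + 1) ≤ μ j := hmono.monotone (by omega)
    exact le_trans (by linarith [h n]) (le_abs_self _)

/-- Since m ≤ m^β, an integer m absorbs both C/c and the factor A. Upper bounds use A = 1; A = 2
makes the ratios at most 1/2 beyond m(n+1). -/
theorem ratio_le {μ : ℕ → ℝ} {c C β : ℝ} (hc : 0 < c) (hC : 0 < C) (hpos : ∀ n, 0 < μ n)
    (hb : ∀ n : ℕ, c * ((n : ℝ) + 1) ^ β ≤ μ n ∧ μ n ≤ C * ((n : ℝ) + 1) ^ β)
    (hβ : 1 < β) {m : ℕ} {A : ℝ} (hA : 1 ≤ A) (hm : A * (C / c) ≤ m) (hm1 : 1 ≤ m) (n j : ℕ) :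
    A * (μ n / μ j) ≤ (((m * (n + 1) : ℕ) : ℝ) / ((j : ℝ) + 1)) ^ β := by
  have hm1' : (1 : ℝ) ≤ m := by exact_mod_cast hm1
  have hmβ : A * (C / c) ≤ (m : ℝ) ^ β := hm.trans (Real.self_le_rpow_of_one_le hm1' hβ.le)
  have hj := (hb j).1
  have hn := (hb n).2
  push_cast
  rw [Real.div_rpow (by positivity) (by positivity), Real.mul_rpow (by positivity) (by positivity)]
  have hjp : 0 < ((j : ℝ) + 1) ^ β := by positivity
  have hnp : 0 < ((n : ℝ) + 1) ^ β := by positivity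
  calc A * (μ n / μ j) ≤ A * ((C * ((n : ℝ) + 1) ^ β) / (c * ((j : ℝ) + 1) ^ β)) := by
        have := hpos j
        gcongr
    _ = (A * (C / c)) * ((n : ℝ) + 1) ^ β / ((j : ℝ) + 1) ^ β := by field_simp
    _ ≤ _ := by gcongr

theorem add_one_le_rpow {μ : ℕ → ℝ} {c β : ℝ} (hc : 0 < c) (hβ : 1 < β) {n : ℕ}
    (hn : c * ((n : ℝ) + 1) ^ β ≤ μ n) :
    (n : ℝ) + 1 ≤ c ^ (-1 / β) * μ n ^ (1 / β) := by
  have hp : 0 < ((n : ℝ) + 1) ^ β := by positivity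
  have hβ0 : β ≠ 0 := by linarith
  have h1 := Real.rpow_le_rpow (by positivity) hn (z := 1 / β) (by positivity)
  rw [Real.mul_rpow hc.le hp.le, ← Real.rpow_mul (by positivity), mul_one_div_cancel hβ0,
    Real.rpow_one] at h1
  have h2 : c ^ (-1 / β) * c ^ (1 / β) = 1 := by
    rw [← Real.rpow_add hc]; ring_nf; exact Real.rpow_zero c
  calc (n : ℝ) + 1 = c ^ (-1 / β) * (c ^ (1 / β) * ((n : ℝ) + 1)) := by
        rw [← mul_assoc, h2, one_mul]
    _ ≤ _ := mul_le_mul_of_nonneg_left h1 (by positivity)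

theorem exists_prod_one_add_le {μ : ℕ → ℝ} {c C β : ℝ} (hc : 0 < c) (hC : 0 < C)
    (hpos : ∀ n, 0 < μ n)
    (hb : ∀ n : ℕ, c * ((n : ℝ) + 1) ^ β ≤ μ n ∧ μ n ≤ C * ((n : ℝ) + 1) ^ β)
    (hβ : 1 < β) :
    ∃ B : ℝ, 0 < B ∧ ∀ (n : ℕ) (F : Finset ℕ),
      ∏ j ∈ F, (1 + μ n / μ j) ≤ Real.exp (B * μ n ^ (1 / β)) := by
  obtain ⟨m, hm⟩ := exists_nat_ge (max (C / c) 1)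
  have hm1' : (1 : ℝ) ≤ m := (le_max_right _ _).trans hm
  have hm1 : 1 ≤ m := by exact_mod_cast hm1'
  have hz := zetaSum_nonneg β
  refine ⟨(4 * β + zetaSum β) * m * c ^ (-1 / β), by positivity, fun n F => ?_⟩
  calc ∏ j ∈ F, (1 + μ n / μ j)
      ≤ ∏ j ∈ F, (1 + (((m * (n + 1) : ℕ) : ℝ) / ((j : ℝ) + 1)) ^ β) := by
        refine Finset.prod_le_prod (fun j _ => ?_) fun j _ => ?_
        · have := div_pos (hpos n) (hpos j); linarith
        · have := ratio_le hc hC hpos hb hβ le_rfl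
            (by rw [one_mul]; exact (le_max_left _ _).trans hm) hm1 n j
          linarith
    _ ≤ Real.exp ((4 * β + zetaSum β) * ((m * (n + 1) : ℕ) : ℝ)) :=
        prod_one_add_rpow_le hβ (by positivity) F
    _ ≤ _ := by
        rw [Real.exp_le_exp]
        push_cast
        have := add_one_le_rpow hc hβ (hb n).1
        calc _ = (4 * β + zetaSum β) * m * ((n : ℝ) + 1) := by ring
          _ ≤ (4 * β + zetaSum β) * m * (c ^ (-1 / β) * μ n ^ (1 / β)) :=
            mul_le_mul_of_nonneg_left this (by positivity)
          _ = _ := by ring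

theorem exp_neg_two_mul_le {x : ℝ} (h0 : 0 ≤ x) (h1 : x ≤ 1 / 2) :
    Real.exp (-(2 * x)) ≤ 1 - x := by
  rw [Real.exp_neg, inv_le_comm₀ (Real.exp_pos _) (by linarith)]
  refine le_trans ?_ (Real.add_one_le_exp _)
  rw [inv_le_iff_one_le_mul₀ (by linarith)]
  nlinarith

theorem exists_le_abs_prod_one_sub {μ : ℕ → ℝ} {c C β θ s : ℝ} (hc : 0 < c) (hC : 0 < C)
    (hpos : ∀ n, 0 < μ n) (hmono : StrictMono μ)
    (hb : ∀ n : ℕ, c * ((n : ℝ) + 1) ^ β ≤ μ n ∧ μ n ≤ C * ((n : ℝ) + 1) ^ β)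
    (hβ : 1 < β) (hθ : 0 < θ) (hs : 0 ≤ s) (hgap : GapCondition μ θ s) :
    ∃ A B : ℝ, 0 < A ∧ 0 < B ∧ ∀ (n : ℕ) (F : Finset ℕ), n ∉ F →
      Real.exp (-(((n : ℝ) + 1) * (A + B * Real.log ((n : ℝ) + 1)))) ≤
        |∏ j ∈ F, (1 - μ n / μ j)| := by
  obtain ⟨m, hm⟩ := exists_nat_ge (max (2 * (C / c)) 1)
  have hm1' : (1 : ℝ) ≤ m := (le_max_right _ _).trans hm
  have hm1 : 1 ≤ m := by exact_mod_cast hm1'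
  have hz := zetaSum_nonneg β
  -- (D (n+1)^{s+β})⁻¹ is the gap θ(n+1)^{-s} divided by the bound C W^β for μ_j with j < W.
  set D : ℝ := C * (m : ℝ) ^ β / θ with hD
  have hDp : 0 < D := by positivity
  refine ⟨m * (|Real.log D| + zetaSum β + 1), m * (s + β), by positivity, by positivity,
    fun n F hnF => ?_⟩
  set W : ℕ := m * (n + 1) with hWdef
  have hW : 0 < W := by positivity
  have hWr : (W : ℝ) = m * ((n : ℝ) + 1) := by rw [hWdef]; push_cast; ring
  -- The absolute value keeps x ≥ 0, so the number of near factors may be replaced by its bound W.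
  set x : ℝ := |Real.log D| + (s + β) * Real.log ((n : ℝ) + 1) with hx
  have hlog : 0 ≤ Real.log ((n : ℝ) + 1) := Real.log_nonneg (by linarith [Nat.cast_nonneg (α := ℝ) n])
  have hx0 : 0 ≤ x := by positivity
  have htail : Real.exp (-(W * zetaSum β)) ≤
      ∏ j ∈ F.filter (fun j => W ≤ j), |1 - μ n / μ j| := by
    calc _ ≤ Real.exp (∑ j ∈ F.filter (fun j => W ≤ j),
            -(((W : ℝ) / ((j : ℝ) + 1)) ^ β)) := by
          rw [Real.exp_le_exp, Finset.sum_neg_distrib, neg_le_neg_iff]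
          exact sum_tail_le hβ hW _ fun j hj => (Finset.mem_filter.1 hj).2
      _ = ∏ j ∈ F.filter (fun j => W ≤ j), Real.exp (-(((W : ℝ) / ((j : ℝ) + 1)) ^ β)) :=
          Real.exp_sum _ _
      _ ≤ _ := by
          refine Finset.prod_le_prod (fun j _ => (Real.exp_pos _).le) fun j hj => ?_
          have hj' : W ≤ j := (Finset.mem_filter.1 hj).2
          have h1 := ratio_le hc hC hpos hb hβ one_le_two ((le_max_left _ _).trans hm) hm1 n j
          rw [← hWdef] at h1
          have h2 : ((W : ℝ) / ((j : ℝ) + 1)) ^ β ≤ 1 := by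
            refine Real.rpow_le_one (by positivity) ?_ (by linarith)
            rw [div_le_one (by positivity)]
            have : (W : ℝ) ≤ j := by exact_mod_cast hj'
            linarith
          refine le_trans ?_ (le_abs_self _)
          refine le_trans ?_ (exp_neg_two_mul_le (div_pos (hpos n) (hpos j)).le (by linarith))
          rw [Real.exp_le_exp]
          linarith
  have hhead : Real.exp (-(W * x)) ≤ ∏ j ∈ F.filter (fun j => ¬ W ≤ j), |1 - μ n / μ j| := by
    have hterm : ∀ j ∈ F.filter (fun j => ¬ W ≤ j), Real.exp (-x) ≤ |1 - μ n / μ j| := by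
      intro j hj
      rw [Finset.mem_filter] at hj
      have hjn : j ≠ n := fun h => hnF (h ▸ hj.1)
      have hjW : (j : ℝ) + 1 ≤ W := by exact_mod_cast not_le.1 hj.2
      have h1 : |1 - μ n / μ j| = |μ j - μ n| / μ j := by
        rw [one_sub_div (hpos j).ne', abs_div, abs_of_pos (hpos j)]
      have h2 : μ j ≤ C * (m : ℝ) ^ β * ((n : ℝ) + 1) ^ β := by
        calc μ j ≤ C * ((j : ℝ) + 1) ^ β := (hb j).2
          _ ≤ C * (W : ℝ) ^ β := by gcongr
          _ = _ := by rw [hWr, Real.mul_rpow (by positivity) (by positivity), mul_assoc]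
      have h3 : Real.exp (-x) ≤ (D * ((n : ℝ) + 1) ^ (s + β))⁻¹ := by
        rw [Real.exp_neg]
        refine inv_anti₀ (by positivity) ?_
        rw [hx, Real.exp_add, mul_comm (s + β), Real.exp_mul, Real.exp_log (by positivity)]
        refine mul_le_mul_of_nonneg_right ?_ (by positivity)
        calc D = Real.exp (Real.log D) := (Real.exp_log hDp).symm
          _ ≤ _ := Real.exp_le_exp.2 (le_abs_self _)
      refine h3.trans ?_
      rw [h1, le_div_iff₀ (hpos j)]
      refine le_trans ?_ (hgap.le_abs_sub hmono hθ hs hjn)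
      calc _ ≤ (D * ((n : ℝ) + 1) ^ (s + β))⁻¹ * (C * (m : ℝ) ^ β * ((n : ℝ) + 1) ^ β) :=
            mul_le_mul_of_nonneg_left h2 (by positivity)
        _ = _ := by
            rw [Real.rpow_add (by positivity), Real.rpow_neg (by positivity), hD]
            field_simp
    have hcard : (F.filter fun j => ¬ W ≤ j).card ≤ W := by
      have : (F.filter fun j => ¬ W ≤ j) ⊆ Finset.range W := fun j hj =>
        Finset.mem_range.2 (not_le.1 (Finset.mem_filter.1 hj).2)
      simpa using Finset.card_le_card this
    calc Real.exp (-(W * x)) = Real.exp (-x) ^ W := by rw [← Real.exp_nat_mul]; congr 1; ring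
      _ ≤ Real.exp (-x) ^ (F.filter fun j => ¬ W ≤ j).card :=
          pow_le_pow_of_le_one (Real.exp_pos _).le (Real.exp_le_one_iff.2 (by linarith)) hcard
      _ = ∏ _j ∈ F.filter (fun j => ¬ W ≤ j), Real.exp (-x) := by rw [Finset.prod_const]
      _ ≤ _ := Finset.prod_le_prod (fun _ _ => (Real.exp_pos _).le) hterm
  rw [Finset.abs_prod, ← Finset.prod_filter_mul_prod_filter_not F (fun j => W ≤ j)]
  refine le_trans ?_ (mul_le_mul htail hhead (Real.exp_pos _).le
    (Finset.prod_nonneg fun _ _ => abs_nonneg _))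
  rw [← Real.exp_add, Real.exp_le_exp, hWr, hx]
  have : 0 ≤ (m : ℝ) * ((n : ℝ) + 1) := by positivity
  nlinarith


/-! ### The infinite product and its lower bound. -/

theorem summable_ratio {μ : ℕ → ℝ} {c β : ℝ} (hc : 0 < c) (hβ : 1 < β) (hpos : ∀ n, 0 < μ n)
    (hb : ∀ n : ℕ, c * ((n : ℝ) + 1) ^ β ≤ μ n) (n : ℕ) : Summable fun j => μ n / μ j := by
  have hs : Summable fun q : ℕ => (((q + 1 : ℕ) : ℝ) ^ β)⁻¹ :=
    (summable_nat_add_iff 1).2 (Real.summable_nat_rpow_inv.2 hβ)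
  refine Summable.of_nonneg_of_le (fun j => (div_pos (hpos n) (hpos j)).le) (fun j => ?_)
    (hs.mul_left (μ n / c))
  have := hpos n
  have hj := hb j
  push_cast
  rw [← div_eq_mul_inv, div_div]
  exact div_le_div_of_nonneg_left this.le (by positivity) hj

theorem multipliable_one_sub_ratio {μ : ℕ → ℝ} (n : ℕ) (h : Summable fun j => μ n / μ j) :
    Multipliable fun j : {j : ℕ // j ≠ n} => 1 - μ n / μ j := by
  have h1 : Summable fun j : {j : ℕ // j ≠ n} => -(μ n / μ j) := (h.subtype _).neg
  simpa [sub_eq_add_neg] using Real.multipliable_one_add_of_summable h1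

theorem exists_productLowerBound {μ : ℕ → ℝ} {M c C β θ s : ℝ} (hM : 0 < M) (hc : 0 < c)
    (hC : 0 < C) (hpos : ∀ n, 0 < μ n) (hmono : StrictMono μ)
    (hb : ∀ n : ℕ, c * ((n : ℝ) + 1) ^ β ≤ μ n ∧ μ n ≤ C * ((n : ℝ) + 1) ^ β)
    (hβ : 1 < β) (hθ : 0 < θ) (hs : 0 ≤ s) (hgap : GapCondition μ θ s) :
    ∃ K₀ K₁ : ℝ, ProductLowerBound μ M β K₀ K₁ := by
  obtain ⟨A, B, hA, hB, h⟩ := exists_le_abs_prod_one_sub hc hC hpos hmono hb hβ hθ hs hgap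
  have hβ0 : 0 < β := by linarith
  set P : ℝ := c ^ (-1 / β) * (B / β) with hP
  have hPp : 0 < P := by positivity
  -- The second entry absorbs A and log c when log (n+1) is replaced by (log μ_n - log c)/β; the
  -- first only ensures positivity.
  set K₁ : ℝ := max 1 (β * A / B - Real.log c) with hK₁
  refine ⟨P * M ^ (1 / β), K₁, by positivity, by positivity, fun n => ?_⟩
  have hMM : M ^ (1 / β) * M ^ (-1 / β) = 1 := by
    rw [← Real.rpow_add hM]; ring_nf; exact Real.rpow_zero M
  have hlim := ((multipliable_one_sub_ratio n
    (summable_ratio hc hβ hpos (fun n => (hb n).1) n)).hasProd).abs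
  refine ge_of_tendsto' hlim fun F => ?_
  have hF := h n (F.map (Function.Embedding.subtype _)) (by simp)
  rw [Finset.prod_map] at hF
  refine le_trans ?_ (by simpa [Finset.abs_prod] using hF)
  rw [Real.exp_le_exp, neg_le_neg_iff]
  have hn1 : (1 : ℝ) ≤ (n : ℝ) + 1 := by linarith [Nat.cast_nonneg (α := ℝ) n]
  have hlog0 : 0 ≤ Real.log ((n : ℝ) + 1) := Real.log_nonneg hn1
  have hlog : Real.log ((n : ℝ) + 1) ≤ (Real.log (μ n) - Real.log c) / β := by
    have := Real.log_le_log (by positivity) (hb n).1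
    rw [Real.log_mul hc.ne' (by positivity), Real.log_rpow (by positivity)] at this
    rw [le_div_iff₀ hβ0]
    linarith
  have hK : A + B * Real.log ((n : ℝ) + 1) ≤ (B / β) * (Real.log (μ n) + K₁) := by
    calc _ ≤ A + B * ((Real.log (μ n) - Real.log c) / β) := by gcongr
      _ = (B / β) * (Real.log (μ n) + (β * A / B - Real.log c)) := by field_simp; ring
      _ ≤ _ := by
        have := le_max_right 1 (β * A / B - Real.log c)
        gcongr
  have h2 := add_one_le_rpow hc hβ (hb n).1
  have hmn := hpos n
  calc ((n : ℝ) + 1) * (A + B * Real.log ((n : ℝ) + 1))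
      ≤ (c ^ (-1 / β) * μ n ^ (1 / β)) * ((B / β) * (Real.log (μ n) + K₁)) :=
        mul_le_mul h2 hK (by positivity) (by positivity)
    _ = P * μ n ^ (1 / β) * (Real.log (μ n) + K₁) *
          (M ^ (1 / β) * M ^ (-1 / β)) := by rw [hMM, hP]; ring
    _ = _ := by ring

/-! ### From the product lower bound to coefficient bounds. -/

/-- A bound of `n`-th coefficients of exponential sums on `[0, ∞)`. -/
noncomputable def coeffBound (μ : ℕ → ℝ) (M β K₀ K₂ : ℝ) (n : ℕ) : ℝ :=
  Real.sqrt (μ n / 2) *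
    Real.exp (K₀ * M ^ (-1 / β) * μ n ^ (1 / β) * (Real.log (μ n) + K₂))

theorem coeffBound_pos {μ : ℕ → ℝ} (hpos : ∀ n, 0 < μ n) (M β K₀ K₂ : ℝ) (n : ℕ) :
    0 < coeffBound μ M β K₀ K₂ n :=
  mul_pos (Real.sqrt_pos.2 (half_pos (hpos n))) (Real.exp_pos _)

/-- Passes from the infinite product to arbitrary finite subproducts: outside F use |1 - x| ≤ 1 + x,
and the result completes ∏_F (1 + x) to one finite product, so E is paid only once. -/
theorem tprod_mul_prod_le {ι : Type*} {x : ι → ℝ} (hx : ∀ j, 0 ≤ x j) {E : ℝ}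
    (hE : ∀ G : Finset ι, ∏ j ∈ G, (1 + x j) ≤ E) (hm : Multipliable fun j => 1 - x j)
    (F : Finset ι) :
    |∏' j, (1 - x j)| * ∏ j ∈ F, (1 + x j) ≤ (∏ j ∈ F, |1 - x j|) * E := by
  classical
  refine le_of_tendsto ((hm.hasProd.abs).mul_const _) ?_
  filter_upwards [eventually_ge_atTop F] with G hG
  rw [← Finset.prod_sdiff hG]
  have h1 : ∏ j ∈ G \ F, |1 - x j| ≤ ∏ j ∈ G \ F, (1 + x j) := by
    refine Finset.prod_le_prod (fun _ _ => abs_nonneg _) fun j _ => ?_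
    have := hx j
    rw [abs_le]; constructor <;> linarith
  have h2 : 0 ≤ ∏ j ∈ F, (1 + x j) := Finset.prod_nonneg fun j _ => by have := hx j; positivity
  have h3 : 0 ≤ ∏ j ∈ F, |1 - x j| := Finset.prod_nonneg fun j _ => abs_nonneg _
  calc _ ≤ (∏ j ∈ G \ F, (1 + x j)) * (∏ j ∈ F, |1 - x j|) * ∏ j ∈ F, (1 + x j) := by gcongr
    _ = (∏ j ∈ F, |1 - x j|) * ∏ j ∈ G, (1 + x j) := by rw [← Finset.prod_sdiff hG]; ring
    _ ≤ _ := mul_le_mul_of_nonneg_left (hE G) h3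

theorem ProductLowerBound.exists_coeffBound {μ : ℕ → ℝ} {M c C β K₀ K₁ : ℝ} (hM : 0 < M)
    (hc : 0 < c) (hC : 0 < C) (hpos : ∀ n, 0 < μ n)
    (hb : ∀ n : ℕ, c * ((n : ℝ) + 1) ^ β ≤ μ n ∧ μ n ≤ C * ((n : ℝ) + 1) ^ β)
    (hβ : 1 < β) (h : ProductLowerBound μ M β K₀ K₁) :
    ∃ K₂ : ℝ, 0 < K₂ ∧ ∀ (n : ℕ) (F : Finset ℕ), n ∉ F →
      Real.sqrt (2 * μ n) ≤
        coeffBound μ M β K₀ K₂ n * ∏ j ∈ F, |(μ n - μ j) / (μ n + μ j)| := by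
  obtain ⟨hK₀, hK₁, hlow⟩ := h
  obtain ⟨B, hB, hup⟩ := exists_prod_one_add_le hc hC hpos hb hβ
  have hKM : 0 < K₀ * M ^ (-1 / β) := by positivity
  -- With this increment the extra term in the exponent is exactly B μ_n^{1/β}.
  refine ⟨K₁ + B / (K₀ * M ^ (-1 / β)), by positivity, fun n F hnF => ?_⟩
  set x : {j : ℕ // j ≠ n} → ℝ := fun j => μ n / μ j with hx
  have hx0 : ∀ j, 0 ≤ x j := fun j => (div_pos (hpos n) (hpos j)).le
  -- The halving comes from inserting the factor 1 + μ_n/μ_n = 2; it turns √(2μ_n) into √(μ_n/2).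
  have hE : ∀ G : Finset {j : ℕ // j ≠ n}, ∏ j ∈ G, (1 + x j) ≤
      Real.exp (B * μ n ^ (1 / β)) / 2 := by
    intro G
    have h1 := hup n (insert n (G.map (Function.Embedding.subtype _)))
    rw [Finset.prod_insert (by simp), Finset.prod_map, div_self (hpos n).ne'] at h1
    rw [le_div_iff₀ two_pos]
    change (1 + 1) * ∏ j ∈ G, (1 + x j) ≤ _ at h1
    linarith
  have hmul := multipliable_one_sub_ratio n (summable_ratio hc hβ hpos (fun n => (hb n).1) n)
  have key := tprod_mul_prod_le hx0 hE hmul (F.subtype (fun j => j ≠ n))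
  have e1 : ∏ j ∈ F.subtype (fun j => j ≠ n), (1 + x j) = ∏ j ∈ F, (1 + μ n / μ j) :=
    Finset.prod_subtype_of_mem (fun j => 1 + μ n / μ j) fun j hj h => hnF (h ▸ hj)
  have e2 : ∏ j ∈ F.subtype (fun j => j ≠ n), |1 - x j| = ∏ j ∈ F, |1 - μ n / μ j| :=
    Finset.prod_subtype_of_mem (fun j => |1 - μ n / μ j|) fun j hj h => hnF (h ▸ hj)
  rw [e1, e2] at key
  have hPp : 0 < ∏ j ∈ F, (1 + μ n / μ j) := Finset.prod_pos fun j _ => by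
    have := div_pos (hpos n) (hpos j); positivity
  have e3 : ∏ j ∈ F, |(μ n - μ j) / (μ n + μ j)| =
      (∏ j ∈ F, |1 - μ n / μ j|) / ∏ j ∈ F, (1 + μ n / μ j) := by
    rw [← Finset.prod_div_distrib]
    refine Finset.prod_congr rfl fun j _ => ?_
    have h1 := hpos j
    have h2 := hpos n
    rw [one_sub_div h1.ne', abs_div, abs_div, abs_of_pos h1, abs_of_pos (add_pos h2 h1),
      abs_sub_comm]
    field_simp
    rw [add_comm]
  rw [e3, coeffBound]
  have key2 := (mul_le_mul_of_nonneg_right (hlow n) hPp.le).trans key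
  have h2 := hpos n
  have hsq : Real.sqrt (2 * μ n) = Real.sqrt (μ n / 2) * 2 := by
    rw [show 2 * μ n = μ n / 2 * 2 ^ 2 by ring, Real.sqrt_mul (by positivity),
      Real.sqrt_sq (by norm_num)]
  rw [hsq, mul_assoc]
  refine mul_le_mul_of_nonneg_left ?_ (Real.sqrt_nonneg _)
  rw [← mul_div_assoc, le_div_iff₀ hPp]
  set e : ℝ := K₀ * M ^ (-1 / β) * μ n ^ (1 / β) * (Real.log (μ n) + K₁) with he
  have e4 : K₀ * M ^ (-1 / β) * μ n ^ (1 / β) *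
      (Real.log (μ n) + (K₁ + B / (K₀ * M ^ (-1 / β)))) = e + B * μ n ^ (1 / β) := by
    rw [he]; field_simp
    ring
  rw [e4, Real.exp_add]
  have h3 := mul_le_mul_of_nonneg_left key2 (Real.exp_pos e).le
  rw [← mul_assoc, ← Real.exp_add, add_neg_cancel, Real.exp_zero, one_mul] at h3
  linarith

/-- As 1/β < 1, the exponent x^{1/β} log x is o(x), so exp(-xt) wins for every t > 0. -/
theorem summable_coeffBound_mul_exp {μ : ℕ → ℝ} {c β : ℝ} (hc : 0 < c) (hβ : 1 < β)
    (hpos : ∀ n, 0 < μ n) (hb : ∀ n : ℕ, c * ((n : ℝ) + 1) ^ β ≤ μ n) (M K₀ K₂ : ℝ)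
    {t : ℝ} (ht : 0 < t) :
    Summable fun n => coeffBound μ M β K₀ K₂ n * Real.exp (-μ n * t) := by
  have hlin : ∀ n : ℕ, c * ((n : ℝ) + 1) ≤ μ n := fun n => by
    refine le_trans (mul_le_mul_of_nonneg_left ?_ hc.le) (hb n)
    exact Real.self_le_rpow_of_one_le (by linarith [Nat.cast_nonneg (α := ℝ) n]) hβ.le
  have hμ : Tendsto μ atTop atTop := by
    refine tendsto_atTop_mono hlin ?_
    exact (tendsto_atTop_add_const_right _ _ tendsto_natCast_atTop_atTop).const_mul_atTop hc
  set K := K₀ * M ^ (-1 / β) with hK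
  have hβ1 : 0 < 1 - 1 / β := by
    rw [sub_pos, div_lt_one (by linarith)]; exact hβ
  have hlog : (fun x : ℝ => Real.log x) =o[atTop] fun x => x ^ (1 - 1 / β) :=
    isLittleO_log_rpow_atTop hβ1
  have hone : (fun _ : ℝ => K₂) =o[atTop] fun x : ℝ => x ^ (1 - 1 / β) :=
    isLittleO_const_left.2 (Or.inr (tendsto_norm_atTop_atTop.comp (tendsto_rpow_atTop hβ1)))
  have h1 : (fun x : ℝ => K * x ^ (1 / β) * (Real.log x + K₂)) =o[atTop] fun x => x := by
    have h2 := ((isBigO_refl (fun x : ℝ => x ^ (1 / β)) atTop).const_mul_left K).mul_isLittleO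
      (hlog.add hone)
    refine h2.congr' (Eventually.of_forall fun x => rfl) ?_
    filter_upwards [eventually_gt_atTop 0] with x hx
    rw [← Real.rpow_add hx]; ring_nf; exact Real.rpow_one x
  -- The square root and the exponential each cost at most exp(tx/4), leaving half of the decay.
  have h3 : ∀ᶠ x : ℝ in atTop, Real.sqrt (x / 2) *
      Real.exp (K * x ^ (1 / β) * (Real.log x + K₂)) * Real.exp (-x * t) ≤
        Real.exp (-(t / 2) * x) := by
    filter_upwards [h1.bound (show 0 < t / 4 by positivity), eventually_gt_atTop 0,
      eventually_ge_atTop ((4 / t) ^ 2)] with x hx hx0 hx1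
    rw [Real.norm_eq_abs, Real.norm_eq_abs, abs_of_pos hx0] at hx
    have hx2 := (le_abs_self _).trans hx
    have h4 : Real.sqrt (x / 2) ≤ Real.exp (t / 4 * x) := by
      have h5 : Real.sqrt (x / 2) ≤ Real.sqrt x := Real.sqrt_le_sqrt (by linarith)
      have h6 : 4 / t ≤ Real.sqrt x := Real.le_sqrt_of_sq_le hx1
      have h7 : Real.sqrt x ≤ t / 4 * x := by
        have h8 := Real.sq_sqrt hx0.le
        rw [div_le_iff₀ ht] at h6
        nlinarith [Real.sqrt_nonneg x]
      linarith [Real.add_one_le_exp (t / 4 * x)]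
    calc _ ≤ Real.exp (t / 4 * x) * Real.exp (t / 4 * x) * Real.exp (-x * t) := by gcongr
      _ = _ := by rw [← Real.exp_add, ← Real.exp_add]; congr 1; ring
  have hgeo : Summable fun n : ℕ => Real.exp (n * (-(t / 2) * c)) :=
    Real.summable_exp_nat_mul_iff.2 (by nlinarith)
  refine hgeo.of_norm_bounded_eventually_nat ?_
  filter_upwards [hμ.eventually h3] with n hn
  rw [Real.norm_of_nonneg (mul_nonneg (coeffBound_pos hpos _ _ _ _ n).le (Real.exp_pos _).le)]
  refine hn.trans (Real.exp_le_exp.2 ?_)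
  nlinarith [hlin n]

/-! ### The Cauchy quadratic form and Blaschke factors. -/

/-- Since (x+m)(y+m) - (x-m)(y-m) = 2m(x+y), inserting one Blaschke factor subtracts the square 2μ_m
(∑ b_k/(μ_k+μ_m))². -/
theorem quadForm_le {μ : ℕ → ℝ} (hpos : ∀ n, 0 < μ n) (G F : Finset ℕ) (a : ℕ → ℝ) :
    ∑ k ∈ G, ∑ l ∈ G, (a k * ∏ m ∈ F, (μ k - μ m) / (μ k + μ m)) *
        (a l * ∏ m ∈ F, (μ l - μ m) / (μ l + μ m)) / (μ k + μ l) ≤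
      ∑ k ∈ G, ∑ l ∈ G, a k * a l / (μ k + μ l) := by
  induction F using Finset.induction_on with
  | empty => simp
  | insert m F hm ih =>
    refine le_trans ?_ ih
    simp only [Finset.prod_insert hm]
    set b : ℕ → ℝ := fun k => a k * ∏ m ∈ F, (μ k - μ m) / (μ k + μ m) with hb
    have h1 : ∑ k ∈ G, ∑ l ∈ G, b k * b l / (μ k + μ l) =
        ∑ k ∈ G, ∑ l ∈ G, (b k * ((μ k - μ m) / (μ k + μ m))) *
          (b l * ((μ l - μ m) / (μ l + μ m))) / (μ k + μ l) +
        2 * μ m * (∑ k ∈ G, b k / (μ k + μ m)) ^ 2 := by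
      rw [sq, Finset.sum_mul_sum, Finset.mul_sum, ← Finset.sum_add_distrib]
      refine Finset.sum_congr rfl fun k _ => ?_
      rw [Finset.mul_sum, ← Finset.sum_add_distrib]
      refine Finset.sum_congr rfl fun l _ => ?_
      have h1 := hpos k
      have h2 := hpos l
      have h3 := hpos m
      field_simp
      ring
    rw [h1]
    have h2 := hpos m
    refine le_trans (le_of_eq ?_) (le_add_of_nonneg_right (by positivity))
    refine Finset.sum_congr rfl fun k _ => Finset.sum_congr rfl fun l _ => ?_
    simp only [hb]
    ring

/-- The Blaschke product over F vanishes at every μ_k with k ∈ F, so one diagonal term remains. -/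
theorem sq_coeff_le_quadForm {μ : ℕ → ℝ} (hpos : ∀ n, 0 < μ n) {F : Finset ℕ} {n : ℕ}
    (hn : n ∉ F) (a : ℕ → ℝ) :
    (a n * ∏ m ∈ F, (μ n - μ m) / (μ n + μ m)) ^ 2 / (2 * μ n) ≤
      ∑ k ∈ insert n F, ∑ l ∈ insert n F, a k * a l / (μ k + μ l) := by
  refine le_trans (le_of_eq ?_) (quadForm_le hpos (insert n F) F a)
  have hz : ∀ k ∈ F, ∏ m ∈ F, (μ k - μ m) / (μ k + μ m) = 0 := fun k hk =>
    Finset.prod_eq_zero hk (by simp)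
  rw [Finset.sum_insert hn, Finset.sum_insert hn, Finset.sum_eq_zero, Finset.sum_eq_zero]
  · ring
  · intro k hk
    refine Finset.sum_eq_zero fun l _ => ?_
    rw [hz k hk]; simp
  · intro k hk
    rw [hz k hk]; simp


/-! ### Exponential sums in L²[0,T] and their coefficients. -/

theorem timeInterval_top : timeInterval ⊤ = Set.Ici 0 := by
  ext t; simp [timeInterval]

theorem timeInterval_coe (τ : ℝ) : timeInterval (τ : EReal) = Set.Icc 0 τ := by
  ext t; simp [timeInterval]

/-- The exponential sum `∑ a_k exp (-μ_k t)`. -/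
noncomputable def expSum (μ : ℕ → ℝ) (a : ℕ →₀ ℝ) (t : ℝ) : ℝ :=
  a.sum fun k c => c * Real.exp (-μ k * t)

/-- The exponential sum `∑ a_k exp (-μ_k t)` as an element of `L²[0, T]`. -/
noncomputable def expSumL2 (T : EReal) (μ : ℕ → ℝ) (hpos : ∀ n, 0 < μ n) :
    (ℕ →₀ ℝ) →ₗ[ℝ] L2 T :=
  Finsupp.linearCombination ℝ (expL2 T μ hpos)

theorem continuous_expSum (μ : ℕ → ℝ) (a : ℕ →₀ ℝ) : Continuous (expSum μ a) := by
  unfold expSum Finsupp.sum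
  fun_prop

theorem expSum_eq_tsum (μ : ℕ → ℝ) (a : ℕ →₀ ℝ) (t : ℝ) :
    expSum μ a t = ∑' k, a k * Real.exp (-μ k * t) := by
  rw [tsum_eq_sum (s := a.support)]
  · rfl
  · intro k hk
    rw [Finsupp.notMem_support_iff.1 hk, zero_mul]

theorem expL2_coeFn (T : EReal) (μ : ℕ → ℝ) (hpos : ∀ n, 0 < μ n) (n : ℕ) :
    expL2 T μ hpos n =ᵐ[timeMeasure T] fun t => Real.exp (-μ n * t) :=
  MemLp.coeFn_toLp _

theorem expSumL2_coeFn (T : EReal) (μ : ℕ → ℝ) (hpos : ∀ n, 0 < μ n) (a : ℕ →₀ ℝ) :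
    expSumL2 T μ hpos a =ᵐ[timeMeasure T] expSum μ a := by
  induction a using Finsupp.induction_linear with
  | zero =>
    rw [map_zero]
    filter_upwards [Lp.coeFn_zero ℝ 2 (timeMeasure T)] with t ht
    rw [ht]; simp [expSum]
  | add f g hf hg =>
    rw [map_add]
    filter_upwards [Lp.coeFn_add (expSumL2 T μ hpos f) (expSumL2 T μ hpos g), hf, hg]
      with t ht hft hgt
    rw [ht, Pi.add_apply, hft, hgt, expSum, expSum, expSum, Finsupp.sum_add_index']
    · simp
    · intros; ring
  | single k c =>
    rw [expSumL2, Finsupp.linearCombination_single]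
    filter_upwards [Lp.coeFn_smul c (expL2 T μ hpos k), expL2_coeFn T μ hpos k] with t ht hkt
    rw [ht, Pi.smul_apply, hkt, expSum, Finsupp.sum_single_index (by simp), smul_eq_mul]

theorem norm_sq_expSumL2 (T : EReal) (μ : ℕ → ℝ) (hpos : ∀ n, 0 < μ n) (a : ℕ →₀ ℝ) :
    ‖expSumL2 T μ hpos a‖ ^ 2 = ∫ t, expSum μ a t ^ 2 ∂(timeMeasure T) := by
  rw [← real_inner_self_eq_norm_sq, L2.inner_def]
  refine integral_congr_ae ?_
  filter_upwards [expSumL2_coeFn T μ hpos a] with t ht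
  rw [ht]
  simp [sq]

theorem integrable_sq_expSum (T : EReal) (μ : ℕ → ℝ) (hpos : ∀ n, 0 < μ n) (a : ℕ →₀ ℝ) :
    Integrable (fun t => expSum μ a t ^ 2) (timeMeasure T) :=
  ((memLp_congr_ae (expSumL2_coeFn T μ hpos a)).1 (Lp.memLp _)).integrable_sq

theorem inner_expL2_left (T : EReal) (μ : ℕ → ℝ) (hpos : ∀ n, 0 < μ n) (k : ℕ) (ψ : L2 T) :
    inner ℝ (expL2 T μ hpos k) ψ = ∫ t, Real.exp (-μ k * t) * ψ t ∂(timeMeasure T) := by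
  rw [L2.inner_def]
  refine integral_congr_ae ?_
  filter_upwards [expL2_coeFn T μ hpos k] with t ht
  rw [ht]
  simp [mul_comm]

theorem inner_expL2_top (μ : ℕ → ℝ) (hpos : ∀ n, 0 < μ n) (k l : ℕ) :
    inner ℝ (expL2 ⊤ μ hpos k) (expL2 ⊤ μ hpos l) = 1 / (μ k + μ l) := by
  rw [inner_expL2_left]
  have h1 : ∫ t, Real.exp (-μ k * t) * expL2 ⊤ μ hpos l t ∂(timeMeasure ⊤) =
      ∫ t, Real.exp (-(μ k + μ l) * t) ∂(timeMeasure ⊤) := by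
    refine integral_congr_ae ?_
    filter_upwards [expL2_coeFn ⊤ μ hpos l] with t ht
    rw [ht, ← Real.exp_add]
    congr 1; ring
  rw [h1, timeMeasure, timeInterval_top, integral_Ici_eq_integral_Ioi,
    integral_exp_mul_Ioi (by linarith [hpos k, hpos l])]
  simp [neg_div_neg_eq, -neg_add_rev]

theorem norm_sq_expSumL2_top {μ : ℕ → ℝ} (hpos : ∀ n, 0 < μ n) (a : ℕ →₀ ℝ) {G : Finset ℕ}
    (hG : a.support ⊆ G) :
    ‖expSumL2 ⊤ μ hpos a‖ ^ 2 = ∑ k ∈ G, ∑ l ∈ G, a k * a l / (μ k + μ l) := by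
  rw [← real_inner_self_eq_norm_sq, expSumL2, Finsupp.linearCombination_apply,
    Finsupp.sum_of_support_subset _ hG _ (by simp), sum_inner]
  refine Finset.sum_congr rfl fun k _ => ?_
  rw [inner_sum]
  refine Finset.sum_congr rfl fun l _ => ?_
  rw [real_inner_smul_left, real_inner_smul_right, inner_expL2_top]
  ring

theorem abs_coeff_le {μ : ℕ → ℝ} (hpos : ∀ n, 0 < μ n) {n : ℕ} {R : ℝ}
    (hR : ∀ F : Finset ℕ, n ∉ F →
      Real.sqrt (2 * μ n) ≤ R * ∏ j ∈ F, |(μ n - μ j) / (μ n + μ j)|) (a : ℕ →₀ ℝ) :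
    |a n| ≤ R * ‖expSumL2 ⊤ μ hpos a‖ := by
  set F := a.support.erase n with hF
  have hn : n ∉ F := Finset.notMem_erase n _
  have h1 := sq_coeff_le_quadForm hpos hn a
  rw [← norm_sq_expSumL2_top hpos a (Finset.insert_erase_subset n _)] at h1
  have h0 := hpos n
  set Q := ∏ j ∈ F, |(μ n - μ j) / (μ n + μ j)| with hQ
  set N := ‖expSumL2 ⊤ μ hpos a‖ with hN
  have hS : 0 < Real.sqrt (2 * μ n) := Real.sqrt_pos.2 (by positivity)
  have hRF := hR F hn
  have hQ0 : 0 ≤ Q := Finset.prod_nonneg fun _ _ => abs_nonneg _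
  have hQp : 0 < Q := lt_of_le_of_ne hQ0 fun h => by
    rw [← hQ, ← h, mul_zero] at hRF; linarith
  have h2 : |a n| * Q ≤ Real.sqrt (2 * μ n) * N := by
    rw [hQ, ← Finset.abs_prod, ← abs_mul]
    refine abs_le_of_sq_le_sq ?_ (by positivity)
    rw [mul_pow (Real.sqrt _), Real.sq_sqrt (by positivity)]
    rw [div_le_iff₀ (by positivity)] at h1
    linarith
  refine le_of_mul_le_mul_right ?_ hQp
  calc |a n| * Q ≤ Real.sqrt (2 * μ n) * N := h2
    _ ≤ (R * Q) * N := mul_le_mul_of_nonneg_right hRF (norm_nonneg _)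
    _ = R * N * Q := by ring

/-! ### Comparison of [0,T] with [0,∞) by compactness. -/

theorem tendsto_expSum {μ R x : ℕ → ℝ} {b : ℕ → ℕ →₀ ℝ} {t : ℝ}
    (hs : Summable fun k => R k * Real.exp (-μ k * t)) (hb : ∀ j k, |b j k| ≤ R k)
    (hx : ∀ k, Tendsto (fun j => b j k) atTop (𝓝 (x k))) :
    Tendsto (fun j => expSum μ (b j) t) atTop (𝓝 (∑' k, x k * Real.exp (-μ k * t))) := by
  simp only [expSum_eq_tsum]
  refine tendsto_tsum_of_dominated_convergence hs (fun k => (hx k).mul_const _)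
    (Eventually.of_forall fun j k => ?_)
  rw [norm_mul, Real.norm_eq_abs, Real.norm_of_nonneg (Real.exp_pos _).le]
  exact mul_le_mul_of_nonneg_right (hb j k) (Real.exp_pos _).le

/-- The series is holomorphic on Re z > δ for every δ > 0, so the identity theorem applies; δ is
taken below both t and τ. -/
theorem dirichletSeries_eq_zero {μ R x : ℕ → ℝ} (hpos : ∀ n, 0 < μ n)
    (hs : ∀ t : ℝ, 0 < t → Summable fun k => R k * Real.exp (-μ k * t))
    (hxR : ∀ k, |x k| ≤ R k) {τ : ℝ} (hτ : 0 < τ)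
    (h0 : ∀ᵐ t ∂(timeMeasure (τ : EReal)), ∑' k, x k * Real.exp (-μ k * t) = 0)
    {t : ℝ} (ht : 0 < t) : ∑' k, x k * Real.exp (-μ k * t) = 0 := by
  set δ := min t τ / 2 with hδ
  have hmin : 0 < min t τ := lt_min ht hτ
  have hδ0 : 0 < δ := half_pos hmin
  have hδt : δ < t := (half_lt_self hmin).trans_le (min_le_left _ _)
  have hδτ : δ < τ := (half_lt_self hmin).trans_le (min_le_right _ _)
  set G : ℂ → ℂ := fun z => ∑' k, (x k : ℂ) * Complex.exp (-(μ k : ℂ) * z) with hG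
  have hGr : ∀ r : ℝ, G r = ((∑' k, x k * Real.exp (-μ k * r) : ℝ) : ℂ) := fun r => by
    rw [Complex.ofReal_tsum]
    simp [hG]
  have hU : IsOpen {z : ℂ | δ < z.re} := isOpen_lt continuous_const Complex.continuous_re
  have hdiff : DifferentiableOn ℂ G {z : ℂ | δ < z.re} := by
    refine Complex.differentiableOn_tsum_of_summable_norm (hs δ hδ0) (fun k => ?_) hU ?_
    · fun_prop
    · intro k z hz
      rw [norm_mul, Complex.norm_exp, Complex.norm_real, Real.norm_eq_abs]
      refine mul_le_mul (hxR k) (Real.exp_le_exp.2 ?_) (Real.exp_pos _).le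
        ((abs_nonneg _).trans (hxR k))
      have hz' : δ < z.re := hz
      have := hpos k
      simp only [Complex.mul_re, Complex.neg_re, Complex.ofReal_re, Complex.neg_im,
        Complex.ofReal_im]
      nlinarith
  have han : AnalyticOnNhd ℂ G {z : ℂ | δ < z.re} := hdiff.analyticOnNhd hU
  -- Vanishing almost everywhere on [0,τ] still gives zeros accumulating at τ from the left.
  have hfreq : ∃ᶠ r : ℝ in 𝓝[<] τ, ∑' k, x k * Real.exp (-μ k * r) = 0 := by
    intro hev
    obtain ⟨l, hl, hlsub⟩ := (mem_nhdsLT_iff_exists_Ioo_subset' hτ).1 hev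
    rw [timeMeasure, timeInterval_coe, ae_restrict_iff' measurableSet_Icc, ae_iff] at h0
    have hsub : Set.Ioo (max l 0) τ ⊆ {r | ¬ (r ∈ Set.Icc 0 τ →
        ∑' k, x k * Real.exp (-μ k * r) = 0)} := by
      intro r hr himp
      have hr1 : l < r := (le_max_left _ _).trans_lt hr.1
      have hr2 : 0 < r := (le_max_right _ _).trans_lt hr.1
      exact hlsub ⟨hr1, hr.2⟩ (himp ⟨hr2.le, hr.2.le⟩)
    have h1 := measure_mono_null hsub h0
    rw [Real.volume_Ioo, ENNReal.ofReal_eq_zero] at h1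
    have : max l 0 < τ := max_lt hl hτ
    linarith
  have hmap : Tendsto (fun r : ℝ => (r : ℂ)) (𝓝[<] τ) (𝓝[≠] (τ : ℂ)) := by
    refine tendsto_nhdsWithin_iff.2 ⟨?_, ?_⟩
    · exact (Complex.continuous_ofReal.tendsto τ).mono_left nhdsWithin_le_nhds
    · filter_upwards [self_mem_nhdsWithin] with r hr
      have hr' : r < τ := hr
      simpa using hr'.ne
  have hz : Set.EqOn G 0 {z : ℂ | δ < z.re} := by
    refine han.eqOn_zero_of_preconnected_of_frequently_eq_zero
      (convex_halfSpace_re_gt δ).isPreconnected (z₀ := (τ : ℂ)) (by simpa using hδτ) ?_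
    refine hmap.frequently (hfreq.mono fun r hr => ?_)
    rw [hGr, hr, Complex.ofReal_zero]
  have := hz (show (t : ℂ) ∈ {z : ℂ | δ < z.re} by simpa using hδt)
  rw [hGr, Pi.zero_apply] at this
  exact_mod_cast this

/-- Supplies an integrable majorant on (τ,∞), uniform over all sums with coefficients bounded by R.
-/
theorem abs_expSum_le {μ R : ℕ → ℝ} (hmono : StrictMono μ) {a : ℕ →₀ ℝ}
    (ha : ∀ k, |a k| ≤ R k) {τ t : ℝ} (hτt : τ ≤ t)
    (hs : Summable fun k => R k * Real.exp (-μ k * τ)) :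
    |expSum μ a t| ≤ (∑' k, R k * Real.exp (-μ k * τ)) * Real.exp (-μ 0 * (t - τ)) := by
  have hR : ∀ k, 0 ≤ R k := fun k => (abs_nonneg _).trans (ha k)
  calc |expSum μ a t| ≤ ∑ k ∈ a.support, |a k * Real.exp (-μ k * t)| :=
        Finset.abs_sum_le_sum_abs _ _
    _ ≤ ∑ k ∈ a.support, (R k * Real.exp (-μ k * τ)) * Real.exp (-μ 0 * (t - τ)) := by
        refine Finset.sum_le_sum fun k _ => ?_
        rw [abs_mul, abs_of_pos (Real.exp_pos _), mul_assoc, ← Real.exp_add]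
        refine mul_le_mul (ha k) (Real.exp_le_exp.2 ?_) (Real.exp_pos _).le (hR k)
        have : μ 0 ≤ μ k := hmono.monotone (Nat.zero_le k)
        nlinarith
    _ = (∑ k ∈ a.support, R k * Real.exp (-μ k * τ)) * Real.exp (-μ 0 * (t - τ)) :=
        (Finset.sum_mul _ _ _).symm
    _ ≤ _ := mul_le_mul_of_nonneg_right
        (hs.sum_le_tsum _ fun k _ => mul_nonneg (hR k) (Real.exp_pos _).le) (Real.exp_pos _).le

theorem norm_sq_expSumL2_top_eq_add {μ : ℕ → ℝ} (hpos : ∀ n, 0 < μ n) (a : ℕ →₀ ℝ) {τ : ℝ}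
    (hτ : 0 < τ) :
    ‖expSumL2 ⊤ μ hpos a‖ ^ 2 =
      ‖expSumL2 (τ : EReal) μ hpos a‖ ^ 2 + ∫ t in Set.Ioi τ, expSum μ a t ^ 2 := by
  have hint := integrable_sq_expSum ⊤ μ hpos a
  rw [norm_sq_expSumL2, norm_sq_expSumL2]
  rw [timeMeasure, timeInterval_top, ← Set.Icc_union_Ioi_eq_Ici hτ.le] at *
  rw [timeMeasure, timeInterval_coe]
  refine setIntegral_union ?_ measurableSet_Ioi
    (IntegrableOn.mono_set hint Set.subset_union_left)
    (IntegrableOn.mono_set hint Set.subset_union_right)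
  exact Set.disjoint_left.2 fun t ht ht' => not_lt.2 ht.2 ht'

theorem not_tendsto_zero_of_norm_eq_one {μ R : ℕ → ℝ} (hpos : ∀ n, 0 < μ n)
    (hmono : StrictMono μ) (hs : ∀ t : ℝ, 0 < t → Summable fun k => R k * Real.exp (-μ k * t))
    {τ : ℝ} (hτ : 0 < τ) {b : ℕ → ℕ →₀ ℝ} (hb : ∀ j k, |b j k| ≤ R k)
    (h1 : ∀ j, ‖expSumL2 ⊤ μ hpos (b j)‖ = 1) :
    ¬ Tendsto (fun j => expSumL2 (τ : EReal) μ hpos (b j)) atTop (𝓝 0) := by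
  intro h0
  have hK : IsCompact (Set.univ.pi fun k => Set.Icc (-R k) (R k)) :=
    isCompact_univ_pi fun k => isCompact_Icc
  -- Tychonoff: the coefficient sequences lie in a countable product of compact intervals.
  obtain ⟨x, hx, φ, hφ, hlim⟩ := hK.tendsto_subseq (x := fun j => (b j : ℕ → ℝ))
    fun j k _ => abs_le.1 (hb j k)
  have hlim' : ∀ k, Tendsto (fun j => b (φ j) k) atTop (𝓝 (x k)) := fun k =>
    (tendsto_pi_nhds.1 hlim) k
  have hxR : ∀ k, |x k| ≤ R k := fun k => abs_le.2 (hx k trivial)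
  have hpt : ∀ t : ℝ, 0 < t → Tendsto (fun j => expSum μ (b (φ j)) t) atTop
      (𝓝 (∑' k, x k * Real.exp (-μ k * t))) := fun t ht =>
    tendsto_expSum (hs t ht) (fun j k => hb (φ j) k) hlim'
  have h0φ := h0.comp hφ.tendsto_atTop
  obtain ⟨ψ, hψ, hae⟩ := (tendstoInMeasure_of_tendsto_Lp h0φ).exists_seq_tendsto_ae
  have hzero : ∀ᵐ t ∂(timeMeasure (τ : EReal)), ∑' k, x k * Real.exp (-μ k * t) = 0 := by
    have hne : ∀ᵐ t ∂(timeMeasure (τ : EReal)), t ≠ 0 :=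
      ae_restrict_of_ae (compl_mem_ae_iff.2 (measure_singleton (0 : ℝ)))
    have hmem : ∀ᵐ t ∂(timeMeasure (τ : EReal)), t ∈ Set.Icc 0 τ := by
      rw [timeMeasure, timeInterval_coe]
      exact ae_restrict_mem measurableSet_Icc
    have hall := ae_all_iff.2 fun j => expSumL2_coeFn (τ : EReal) μ hpos (b j)
    filter_upwards [hae, hne, hmem, hall, Lp.coeFn_zero ℝ 2 (timeMeasure (τ : EReal))]
      with t ht htne htm hallt hz
    have htp : 0 < t := lt_of_le_of_ne htm.1 htne.symm
    have h2 := (hpt t htp).comp hψ.tendsto_atTop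
    rw [hz] at ht
    refine tendsto_nhds_unique h2 (ht.congr fun j => ?_)
    exact hallt _
  have hzero' : ∀ t : ℝ, 0 < t → ∑' k, x k * Real.exp (-μ k * t) = 0 := fun t ht =>
    dirichletSeries_eq_zero hpos hs hxR hτ hzero ht
  set H := ∑' k, R k * Real.exp (-μ k * τ) with hH
  -- The limit function is zero on (τ,∞), so the tail energy tends to 0 and the total norm 1 is
  -- contradicted.
  have htail : Tendsto (fun j => ∫ t in Set.Ioi τ, expSum μ (b (φ j)) t ^ 2) atTop
      (𝓝 (∫ _t in Set.Ioi τ, (0 : ℝ))) := by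
    refine tendsto_integral_of_dominated_convergence
      (fun t => H ^ 2 * Real.exp (2 * μ 0 * τ) * Real.exp (-(2 * μ 0) * t))
      (fun j => ((continuous_expSum μ _).pow 2).aestronglyMeasurable) ?_ ?_ ?_
    · exact (integrableOn_exp_mul_Ioi (by linarith [hpos 0]) τ).const_mul _
    · intro j
      filter_upwards [ae_restrict_mem measurableSet_Ioi] with t ht
      have h2 := abs_expSum_le hmono (hb (φ j)) (le_of_lt ht) (hs τ hτ)
      rw [Real.norm_of_nonneg (sq_nonneg _), ← sq_abs]
      refine (pow_le_pow_left₀ (abs_nonneg _) h2 2).trans (le_of_eq ?_)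
      rw [mul_pow, ← Real.exp_nat_mul, mul_assoc, ← Real.exp_add]
      congr 2
      push_cast; ring
    · filter_upwards [ae_restrict_mem measurableSet_Ioi] with t ht
      have htp : 0 < t := hτ.trans ht
      have h2 := (hpt t htp).pow 2
      rwa [hzero' t htp, zero_pow two_ne_zero] at h2
  have hsum := ((h0φ.norm.pow 2).add htail)
  rw [integral_zero, norm_zero, zero_pow two_ne_zero, add_zero] at hsum
  have hconst : Tendsto (fun _ : ℕ => (1 : ℝ)) atTop (𝓝 0) := by
    refine hsum.congr fun j => ?_
    have := norm_sq_expSumL2_top_eq_add hpos (b (φ j)) hτ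
    rw [h1, one_pow] at this
    exact this.symm
  exact one_ne_zero (tendsto_nhds_unique tendsto_const_nhds hconst)

theorem exists_norm_expSumL2_top_le {μ R : ℕ → ℝ} (hpos : ∀ n, 0 < μ n)
    (hmono : StrictMono μ) (hs : ∀ t : ℝ, 0 < t → Summable fun k => R k * Real.exp (-μ k * t))
    (hR : ∀ (a : ℕ →₀ ℝ) (n : ℕ), |a n| ≤ R n * ‖expSumL2 ⊤ μ hpos a‖)
    {T : EReal} (hT : 0 < T) :
    ∃ κ : ℝ, 0 < κ ∧ ∀ a : ℕ →₀ ℝ, ‖expSumL2 ⊤ μ hpos a‖ ≤ κ * ‖expSumL2 T μ hpos a‖ := by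
  induction T with
  | bot => simp at hT
  | top => exact ⟨1, one_pos, fun a => by rw [one_mul]⟩
  | coe τ =>
    have hτ : 0 < τ := by exact_mod_cast hT
    by_contra! hcon
    choose a ha using fun j : ℕ => hcon ((j : ℝ) + 1) (by positivity)
    have hN : ∀ j, 0 < ‖expSumL2 ⊤ μ hpos (a j)‖ := fun j =>
      lt_of_le_of_lt (by positivity) (ha j)
    set b : ℕ → ℕ →₀ ℝ := fun j => ‖expSumL2 ⊤ μ hpos (a j)‖⁻¹ • a j with hbdef
    have h1 : ∀ j, ‖expSumL2 ⊤ μ hpos (b j)‖ = 1 := fun j => by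
      rw [hbdef, map_smul, norm_smul, norm_inv, norm_norm, inv_mul_cancel₀ (hN j).ne']
    refine not_tendsto_zero_of_norm_eq_one hpos hmono hs hτ (b := b)
      (fun j k => by simpa [h1 j] using hR (b j) k) h1 ?_
    refine squeeze_zero_norm (fun j => ?_) tendsto_one_div_add_atTop_nhds_zero_nat
    rw [hbdef, map_smul, norm_smul, norm_inv, norm_norm, inv_mul_eq_div,
      div_le_div_iff₀ (hN j) (by positivity)]
    linarith [ha j]

/-! ### From norms of exponential sums to distances. -/

theorem isComparisonConst_of_norm_le {μ : ℕ → ℝ} (hpos : ∀ n, 0 < μ n) {T : EReal} {κ : ℝ}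
    (hκ : 0 < κ)
    (h : ∀ a : ℕ →₀ ℝ, ‖expSumL2 ⊤ μ hpos a‖ ≤ κ * ‖expSumL2 T μ hpos a‖) :
    IsComparisonConst T μ hpos κ := by
  refine ⟨hκ, fun n => ?_⟩
  rw [dist.eq_def T, closedSpanExcept, Submodule.topologicalClosure_coe, Metric.infDist_closure,
    Metric.le_infDist ⟨0, Submodule.zero_mem _⟩]
  intro y hy
  obtain ⟨a, ha, rfl⟩ := (Finsupp.mem_span_image_iff_linearCombination ℝ).1 hy
  have hmem : expSumL2 ⊤ μ hpos a ∈ closedSpanExcept ⊤ μ hpos n :=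
    Submodule.le_topologicalClosure _
      ((Finsupp.mem_span_image_iff_linearCombination ℝ).2 ⟨a, ha, rfl⟩)
  have h1 : dist ⊤ μ hpos n ≤ ‖expL2 ⊤ μ hpos n - expSumL2 ⊤ μ hpos a‖ := by
    rw [← dist_eq_norm]
    exact Metric.infDist_le_dist_of_mem hmem
  have h2 := h (Finsupp.single n 1 - a)
  have hsingle : ∀ S : EReal, expSumL2 S μ hpos (Finsupp.single n 1) = expL2 S μ hpos n :=
    fun S => by simp [expSumL2]
  rw [map_sub, map_sub, hsingle, hsingle] at h2
  rw [dist_eq_norm, inv_mul_le_iff₀ hκ]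
  exact h1.trans h2

/-- Subtracting from the n-th exponential a finite sum of the others leaves the n-th coefficient
equal to 1, so the coefficient bound applies; taking the closure does not change the distance. -/
theorem inv_le_dist_top {μ : ℕ → ℝ} (hpos : ∀ n, 0 < μ n) {n : ℕ} {R : ℝ} (hRpos : 0 < R)
    (hR : ∀ a : ℕ →₀ ℝ, |a n| ≤ R * ‖expSumL2 ⊤ μ hpos a‖) :
    R⁻¹ ≤ dist ⊤ μ hpos n := by
  rw [dist, closedSpanExcept, Submodule.topologicalClosure_coe, Metric.infDist_closure,
    Metric.le_infDist ⟨0, Submodule.zero_mem _⟩]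
  intro y hy
  obtain ⟨a, ha, rfl⟩ := (Finsupp.mem_span_image_iff_linearCombination ℝ).1 hy
  have han : a n = 0 := by
    by_contra hne
    exact ((Finsupp.mem_supported ℝ a).1 ha (Finsupp.mem_support_iff.2 hne)) rfl
  have h2 := hR (Finsupp.single n 1 - a)
  have hsingle : expSumL2 ⊤ μ hpos (Finsupp.single n 1) = expL2 ⊤ μ hpos n := by
    simp [expSumL2]
  rw [map_sub, hsingle, Finsupp.sub_apply, han, Finsupp.single_eq_same, sub_zero, abs_one] at h2
  rw [dist_eq_norm, inv_le_iff_one_le_mul₀' hRpos]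
  exact h2

/-! ### The optimal biorthogonal function. -/

section Biorthogonal

variable {T : EReal} {μ : ℕ → ℝ} {hpos : ∀ n, 0 < μ n} {n : ℕ}

theorem expL2_mem_closedSpanExcept {k : ℕ} (hk : k ≠ n) :
    expL2 T μ hpos k ∈ closedSpanExcept T μ hpos n :=
  Submodule.le_topologicalClosure _ (Submodule.subset_span ⟨k, hk, rfl⟩)

theorem inner_residual_eq_zero {y : L2 T} (hy : y ∈ closedSpanExcept T μ hpos n) :
    inner ℝ y (expL2 T μ hpos n - nearest T μ hpos n) = 0 := by
  rw [real_inner_comm]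
  exact Submodule.starProjection_inner_eq_zero _ _ hy

theorem isBiorthAt_biorth (hd : 0 < dist T μ hpos n) :
    IsBiorthAt T μ n (biorth T μ hpos n) := by
  intro k
  rw [← inner_expL2_left T μ hpos, biorth, real_inner_smul_right]
  split_ifs with hk
  · subst hk
    have h1 : inner ℝ (expL2 T μ hpos k) (expL2 T μ hpos k - nearest T μ hpos k) =
        dist T μ hpos k ^ 2 := by
      rw [← (nearest_spec T μ hpos k).2, ← real_inner_self_eq_norm_sq, inner_sub_left,
        inner_residual_eq_zero (nearest_spec T μ hpos k).1, sub_zero]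
    rw [h1, inv_mul_cancel₀ (by positivity)]
  · rw [inner_residual_eq_zero (expL2_mem_closedSpanExcept hk), mul_zero]

theorem norm_biorth (hd : 0 < dist T μ hpos n) :
    ‖biorth T μ hpos n‖ = (dist T μ hpos n)⁻¹ := by
  rw [biorth, norm_smul, (nearest_spec T μ hpos n).2, norm_inv, norm_pow,
    Real.norm_of_nonneg hd.le]
  field_simp

theorem IsBiorthAt.inner_eq_zero {ψ : L2 T} (hψ : IsBiorthAt T μ n ψ) {y : L2 T}
    (hy : y ∈ closedSpanExcept T μ hpos n) : inner ℝ ψ y = 0 := by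
  have hle : closedSpanExcept T μ hpos n ≤ (Submodule.span ℝ {ψ})ᗮ := by
    refine Submodule.topologicalClosure_minimal _ (Submodule.span_le.2 ?_)
      (Submodule.isClosed_orthogonal _)
    rintro _ ⟨k, hk, rfl⟩
    rw [SetLike.mem_coe, Submodule.mem_orthogonal_singleton_iff_inner_left, inner_expL2_left,
      hψ k, if_neg hk]
  rw [real_inner_comm]
  exact Submodule.mem_orthogonal_singleton_iff_inner_left.1 (hle hy)

/-- Any biorthogonal ψ has inner product 1 with the residual, whose norm is d_n(T); Cauchy–Schwarz
gives ‖ψ‖ ≥ 1/d_n(T). -/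
theorem IsBiorthAt.norm_biorth_le {ψ : L2 T} (hψ : IsBiorthAt T μ n ψ)
    (hd : 0 < dist T μ hpos n) : ‖biorth T μ hpos n‖ ≤ ‖ψ‖ := by
  have h1 : inner ℝ ψ (expL2 T μ hpos n - nearest T μ hpos n) = 1 := by
    rw [inner_sub_right, hψ.inner_eq_zero (nearest_spec T μ hpos n).1, sub_zero,
      real_inner_comm, inner_expL2_left, hψ n, if_pos rfl]
  have h2 := real_inner_le_norm ψ (expL2 T μ hpos n - nearest T μ hpos n)
  rw [h1, (nearest_spec T μ hpos n).2] at h2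
  rw [norm_biorth hd, inv_le_iff_one_le_mul₀ hd]
  exact h2

end Biorthogonal

end ExpMoment

theorem mainTheorem6 (μ : ℕ → ℝ) (M β σ θ s : ℝ)
    (hpos : ∀ n, 0 < μ n) (hmono : StrictMono μ)
    (hM : 0 < M) (hβ : 1 < β) (hσ : 0 < σ) (hσ1 : σ ≤ 1) (hθ : 0 < θ) (hs : 0 ≤ s)
    (hgrowth : ExpMoment.PowerGrowth μ M β σ) (hgap : ExpMoment.GapCondition μ θ s) :
    (∀ T : EReal, 0 < T → ∃ κ : ℝ, ExpMoment.IsComparisonConst T μ hpos κ) ∧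
    (∃ K₀ K₁ : ℝ, ExpMoment.ProductLowerBound μ M β K₀ K₁) ∧
    ∀ K₀ K₁ : ℝ, ExpMoment.ProductLowerBound μ M β K₀ K₁ →
      ∃ K₂ : ℝ, 0 < K₂ ∧ ∀ T : EReal, 0 < T → ∀ n : ℕ,
        0 < ExpMoment.dist T μ hpos n ∧
        ExpMoment.IsBiorthAt T μ n (ExpMoment.biorth T μ hpos n) ∧
        (∀ ψ : ExpMoment.L2 T, ExpMoment.IsBiorthAt T μ n ψ →
          ‖ExpMoment.biorth T μ hpos n‖ ≤ ‖ψ‖) ∧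
        ∀ κ : ℝ, ExpMoment.IsComparisonConst T μ hpos κ →
          ‖ExpMoment.biorth T μ hpos n‖ ≤
            Real.sqrt (μ n / 2) * κ *
              Real.exp (K₀ * M ^ (-1 / β) * μ n ^ (1 / β) * (Real.log (μ n) + K₂)) := by
  obtain ⟨c, C, hc, hC, hb⟩ := hgrowth.exists_bounds hM hσ hpos
  have hprod := ExpMoment.exists_productLowerBound hM hc hC hpos hmono hb hβ hθ hs hgap
  have hcomp : ∀ T : EReal, 0 < T → ∃ κ : ℝ, ExpMoment.IsComparisonConst T μ hpos κ := by
    intro T hT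
    obtain ⟨K₀, K₁, hK⟩ := hprod
    obtain ⟨K₂, -, hK₂⟩ := hK.exists_coeffBound hM hc hC hpos hb hβ
    obtain ⟨κ, hκ, h⟩ := ExpMoment.exists_norm_expSumL2_top_le hpos hmono
      (fun t ht => ExpMoment.summable_coeffBound_mul_exp hc hβ hpos (fun n => (hb n).1) M K₀ K₂ ht)
      (fun a n => ExpMoment.abs_coeff_le hpos (hK₂ n) a) hT
    exact ⟨κ, ExpMoment.isComparisonConst_of_norm_le hpos hκ h⟩
  refine ⟨hcomp, hprod, fun K₀ K₁ hK => ?_⟩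
  -- K₂ comes from [0,∞) alone, before T is fixed; T enters only through κ.
  obtain ⟨K₂, hK₂pos, hK₂⟩ := hK.exists_coeffBound hM hc hC hpos hb hβ
  refine ⟨K₂, hK₂pos, fun T hT n => ?_⟩
  have hRpos := ExpMoment.coeffBound_pos hpos M β K₀ K₂ n
  have htop := ExpMoment.inv_le_dist_top hpos hRpos
    fun a => ExpMoment.abs_coeff_le hpos (hK₂ n) a
  have hbound : ∀ κ : ℝ, ExpMoment.IsComparisonConst T μ hpos κ →
      (κ * ExpMoment.coeffBound μ M β K₀ K₂ n)⁻¹ ≤ ExpMoment.dist T μ hpos n := fun κ hκ => by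
    rw [mul_inv]
    exact (mul_le_mul_of_nonneg_left htop (inv_pos.2 hκ.1).le).trans (hκ.2 n)
  -- Some comparison constant is needed to know d_n(T) > 0 before any given κ is considered.
  obtain ⟨κ₀, hκ₀⟩ := hcomp T hT
  have hd : 0 < ExpMoment.dist T μ hpos n :=
    (inv_pos.2 (mul_pos hκ₀.1 hRpos)).trans_le (hbound κ₀ hκ₀)
  refine ⟨hd, ExpMoment.isBiorthAt_biorth hd, fun ψ hψ => hψ.norm_biorth_le hd, fun κ hκ => ?_⟩
  rw [ExpMoment.norm_biorth hd]
  refine (inv_le_of_inv_le₀ (mul_pos hκ.1 hRpos) (hbound κ hκ)).trans (le_of_eq ?_)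
  rw [ExpMoment.coeffBound]
  ring
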